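/- **Theorem 3.1.** Let $Y$ be a compact (Hausdorff, effective) orbifold of dimension $n$, and let $v$ be a smooth vector field on $Y$: for each chart $(\tilde U,G_U,\phi_U)$ of an orbifold atlas of $Y$ (with $\tilde U\subset\mathbb R^n$ open and connected, $G_U$ a finite group acting smoothly and effectively on $\tilde U$, and $\phi_U:\tilde U\to Y$ inducing a homeomorphism of $\tilde U/G_U$ onto an open subset of $Y$), a smooth $G_U$-invariant vector field $v_U$ on $\tilde U$, such that the fields $v_U$ are compatible with all transition functions of the atlas. Then there exists a one-parameter group $\{\varphi_t\}_{t\in\mathbb R}$ of diffeomorphisms of $Y$ (that is, $\varphi_0=\mathrm{id}$, $\varphi_{s+t}=\varphi_s\circ\varphi_t$, each $\varphi_t$ is a diffeomorphism of the orbifold $Y$, and $(t,x)\mapsto\varphi_t(x)$ is a smooth map of orbifolds $\mathbb R\times Y\to Y$) generated by $v$: for every $f\in C^\infty(Y)$ and every $x\in Y$, the derivative on the left exists and $$\frac{d}{dt} f(\varphi_t(x))\Big|_{t=0} = v(f)(x).$$ Here $f:Y\to\mathbb C$ belongs to $C^\infty(Y)$ if $f\circ\phi_U$ is smooth for every chart,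 and $v(f)(\phi_U(\tilde x)) = d(f\circ\phi_U)_{\tilde x}(v_U(\tilde x))$ for $\tilde x\in\tilde U$; a map between orbifolds is smooth if around every point of every chart it has a smooth lift to a chart of the target, and a diffeomorphism is a smooth map with a smooth inverse. -/

import Mathlib

open scoped ContDiff

/-- An `n`-dimensional (effective) orbifold chart `(Ũ, G, φ)` on a topological space `X`:
`dom` is `Ũ`, `act` is the smooth action of the finite group `G` on `Ũ`, and `map` is
`φ : Ũ → X`.  The functions `act g` and `map` matter only on `dom`. -/
structure OrbifoldChart (n : ℕ) (X : Type*) [TopologicalSpace X] where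
  dom : Set (EuclideanSpace ℝ (Fin n))
  isOpen_dom : IsOpen dom
  isConnected_dom : IsConnected dom
  G : Type
  [group : Group G]
  [finite : Finite G]
  act : G → EuclideanSpace ℝ (Fin n) → EuclideanSpace ℝ (Fin n)
  act_mem : ∀ g, ∀ z ∈ dom, act g z ∈ dom
  act_one : ∀ z ∈ dom, act 1 z = z
  act_mul : ∀ g h, ∀ z ∈ dom, act (g * h) z = act g (act h z)
  act_smooth : ∀ g, ContDiffOn ℝ ∞ (act g) dom
  act_effective : ∀ g, (∀ z ∈ dom, act g z = z) → g = 1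
  map : EuclideanSpace ℝ (Fin n) → X
  map_continuousOn : ContinuousOn map dom
  /-- `φ` is `G`-invariant, and the induced map `Ũ / G → X` is injective. -/
  map_eq_iff : ∀ z ∈ dom, ∀ w ∈ dom, map z = map w ↔ ∃ g, act g z = w
  /-- `φ : Ũ → X` is open.  As the projection `Ũ → Ũ / G` is continuous, open and surjective, this
  together with `map_continuousOn` and `map_eq_iff` says that `φ` induces a homeomorphism of
  `Ũ / G` onto an open subset of `X`. -/
  map_isOpen : ∀ V ⊆ dom, IsOpen V → IsOpen (map '' V)

attribute [instance] OrbifoldChart.group OrbifoldChart.finite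

/-- The map `l` is an embedding of the orbifold chart `w` into the orbifold chart `c`: a smooth
embedding (an immersion that is a homeomorphism onto its image) `W̃ → Ũ` with `φ_U ∘ l = φ_W`. -/
structure OrbifoldChart.IsChartEmbedding {n : ℕ} {X : Type*} [TopologicalSpace X]
    (w c : OrbifoldChart n X) (l : EuclideanSpace ℝ (Fin n) → EuclideanSpace ℝ (Fin n)) :
    Prop where
  smooth : ContDiffOn ℝ ∞ l w.dom
  immersion : ∀ z ∈ w.dom, Function.Injective (fderiv ℝ l z)
  isEmbedding : Topology.IsEmbedding (w.dom.domRestrict l)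
  mapsTo : Set.MapsTo l w.dom c.dom
  map_comp : ∀ z ∈ w.dom, c.map (l z) = w.map z

/-- An `n`-dimensional orbifold atlas on `X`: a family of orbifold charts that cover `X` and are
locally compatible.  Two atlases are equivalent if their union is an atlas; an orbifold structure
is an equivalence class, here given by a representative.  None of the notions below depends on
the representative. -/
structure OrbifoldAtlas (n : ℕ) (X : Type*) [TopologicalSpace X] where
  charts : Set (OrbifoldChart n X)
  cover : ∀ x : X, ∃ c ∈ charts, x ∈ c.map '' c.dom
  compatible : ∀ c ∈ charts, ∀ d ∈ charts, ∀ x ∈ c.map '' c.dom ∩ d.map '' d.dom,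
    ∃ (w : OrbifoldChart n X) (l m : EuclideanSpace ℝ (Fin n) → EuclideanSpace ℝ (Fin n)),
      x ∈ w.map '' w.dom ∧ w.IsChartEmbedding c l ∧ w.IsChartEmbedding d m

namespace OrbifoldAtlas

variable {n m : ℕ} {X Y : Type*} [TopologicalSpace X] [TopologicalSpace Y]

/-- `f ∈ C^∞(X)`: the composition `f ∘ φ` is smooth for every chart `(Ũ, G, φ)`. -/
def IsSmoothFunction (A : OrbifoldAtlas n X) (f : X → ℂ) : Prop :=
  ∀ c ∈ A.charts, ContDiffOn ℝ ∞ (fun z => f (c.map z)) c.dom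

/-- Smooth maps of orbifolds: maps that have smooth lifts, locally around every point of every
chart. -/
def IsSmoothMap (A : OrbifoldAtlas n X) (B : OrbifoldAtlas m Y) (f : X → Y) : Prop :=
  ∀ c ∈ A.charts, ∀ z ∈ c.dom, ∃ d ∈ B.charts,
    ∃ (W : Set (EuclideanSpace ℝ (Fin n)))
      (F : EuclideanSpace ℝ (Fin n) → EuclideanSpace ℝ (Fin m)),
      IsOpen W ∧ z ∈ W ∧ W ⊆ c.dom ∧ ContDiffOn ℝ ∞ F W ∧
        ∀ w ∈ W, F w ∈ d.dom ∧ d.map (F w) = f (c.map w)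

/-- Diffeomorphisms of orbifolds: smooth maps with a smooth two-sided inverse. -/
def IsDiffeomorphism (A : OrbifoldAtlas n X) (B : OrbifoldAtlas m Y) (f : X → Y) : Prop :=
  A.IsSmoothMap B f ∧
    ∃ g : Y → X, Function.LeftInverse g f ∧ Function.RightInverse g f ∧ B.IsSmoothMap A g

/-- The family `φ t` depends smoothly on `t` as well, that is, `(t, x) ↦ φ t x` is a smooth map of
orbifolds `ℝ × X → X`, where `ℝ × X` has the charts `(ℝ × Ũ, G, id × φ_U)`. -/
def IsSmoothFamily (A : OrbifoldAtlas n X) (φ : ℝ → X → X) : Prop :=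
  ∀ t : ℝ, ∀ c ∈ A.charts, ∀ z ∈ c.dom, ∃ d ∈ A.charts,
    ∃ (W : Set (ℝ × EuclideanSpace ℝ (Fin n)))
      (F : ℝ × EuclideanSpace ℝ (Fin n) → EuclideanSpace ℝ (Fin n)),
      IsOpen W ∧ (t, z) ∈ W ∧ (∀ p ∈ W, p.2 ∈ c.dom) ∧ ContDiffOn ℝ ∞ F W ∧
        ∀ p ∈ W, F p ∈ d.dom ∧ d.map (F p) = φ p.1 (c.map p.2)

/-- (Smooth) one-parameter groups of diffeomorphisms of an orbifold. -/
structure IsOneParameterGroup (A : OrbifoldAtlas n X) (φ : ℝ → X → X) : Prop where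
  map_zero : ∀ x, φ 0 x = x
  map_add : ∀ s t x, φ (s + t) x = φ s (φ t x)
  diffeo : ∀ t, A.IsDiffeomorphism A (φ t)
  smooth : A.IsSmoothFamily φ

/-- A smooth vector field on an orbifold: for every chart `(Ũ, G, φ)` of the atlas a `G`-invariant
smooth vector field on `Ũ`, such that these are compatible with all transition functions
`m ∘ l⁻¹ : l(W̃) → m(W̃)`, where `l : W̃ → Ũ` and `m : W̃ → Ṽ` are embeddings of charts. -/
structure VectorField (A : OrbifoldAtlas n X) where
  toFun : OrbifoldChart n X → EuclideanSpace ℝ (Fin n) → EuclideanSpace ℝ (Fin n)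
  smooth : ∀ c ∈ A.charts, ContDiffOn ℝ ∞ (toFun c) c.dom
  invariant : ∀ c ∈ A.charts, ∀ g, ∀ z ∈ c.dom,
    fderiv ℝ (c.act g) z (toFun c z) = toFun c (c.act g z)
  /-- `l` and `m` have invertible derivatives: if `u` is the pullback of the field on `Ũ` at the
  point `l z`, then it is also the pullback of the field on `Ṽ` at the point `m z`. -/
  compatible : ∀ c ∈ A.charts, ∀ d ∈ A.charts, ∀ (w : OrbifoldChart n X)
    (l m : EuclideanSpace ℝ (Fin n) → EuclideanSpace ℝ (Fin n)),
    w.IsChartEmbedding c l → w.IsChartEmbedding d m →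
    ∀ z ∈ w.dom, ∀ u : EuclideanSpace ℝ (Fin n),
      fderiv ℝ l z u = toFun c (l z) → fderiv ℝ m z u = toFun d (m z)

/-- The value `v(f)(x)` at `x = c.map z` of the function `v(f)`, computed in the chart `c`:
the derivative of `f ∘ c.map` at `z` in the direction of the local representative of `v`. -/
noncomputable def VectorField.applyAt {A : OrbifoldAtlas n X} (v : A.VectorField) (f : X → ℂ)
    (c : OrbifoldChart n X) (z : EuclideanSpace ℝ (Fin n)) : ℂ :=
  fderiv ℝ (fun w => f (c.map w)) z (v.toFun c z)

end OrbifoldAtlas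

/-! The flow is built from integral curves, but these must be handled through lifts: a point of the
orbifold has many preimages in charts. Compatibility and invariance of the local fields make any two
preimages of a point correspond under a local smooth map carrying field to field
(`exists_isTransition`). Hence an integral curve can be lifted through any prescribed preimage of
its value, and uniqueness for ODEs in one chart, with the Hausdorff property and connectedness,
gives uniqueness on intervals (`IsIntegralOn.eqOn`).

Compactness provides one lifetime `ε` for local flows at all points (`exists_forall_hasLocalFlow`).
Uniqueness makes short pieces concatenate, so the lifetime can be doubled repeatedly
(`exists_isIntegralOn_two_mul`) and every integral curve extends to all of `ℝ`. The group law is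
uniqueness again, and smoothness at large times follows from composing small-time maps.

Smooth dependence on initial values in a chart (`ContDiffOn.exists_contDiffOn_localFlow`) comes from
the inverse function theorem on the Banach space of paths, applied to the integral equation with
time rescaled to `[0, 1]`. -/

open Set Filter Topology Metric

universe u

/-! ### Smoothness of composition operators on spaces of continuous maps -/

section Nemytskii

variable {K : Type*} [TopologicalSpace K] [CompactSpace K]
variable {E : Type*} [NormedAddCommGroup E] [NormedSpace ℝ E]
variable {F : Type*} [NormedAddCommGroup F] [NormedSpace ℝ F]

/-- Pointwise application of a continuous family of operators to a continuous family of vectors. -/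
noncomputable def ContinuousMap.applyCLM :
    C(K, E →L[ℝ] F) →L[ℝ] C(K, E) →L[ℝ] C(K, F) :=
  LinearMap.mkContinuous₂
    (LinearMap.mk₂ ℝ (fun (L : C(K, E →L[ℝ] F)) (h : C(K, E)) =>
        (⟨fun s => L s (h s), L.continuous.clm_apply h.continuous⟩ : C(K, F)))
      (fun _ _ _ => by ext; simp) (fun _ _ _ => by ext; simp)
      (fun _ _ _ => by ext; simp) (fun _ _ _ => by ext; simp)) 1
    (fun L h => by
      rw [ContinuousMap.norm_le _ (by positivity)]
      intro s
      rw [one_mul]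
      exact (L s).le_of_opNorm_le_of_le (L.norm_coe_le_norm s) (h.norm_coe_le_norm s))

/-- The mean value inequality applies at each point of `K`; what is needed is a bound on the
oscillation of `f'` near `u s` that is uniform in `s`. -/
theorem ContinuousMap.hasFDerivAt_comp_left {f : E → F} {f' : E → E →L[ℝ] F}
    (hf : ∀ x, HasFDerivAt f (f' x) x) (hc : Continuous f) (hf' : Continuous f') (u : C(K, E)) :
    HasFDerivAt (fun v : C(K, E) => (ContinuousMap.mk f hc).comp v)
      (ContinuousMap.applyCLM ((ContinuousMap.mk f' hf').comp u)) u := by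
  rw [hasFDerivAt_iff_isLittleO, Asymptotics.isLittleO_iff]
  intro c hc0
  have hcont : Continuous fun v : C(K, E) => (ContinuousMap.mk f' hf').comp v :=
    ContinuousMap.continuous_postcomp _
  obtain ⟨δ, hδ, H⟩ := Metric.mem_nhds_iff.1 (hcont.continuousAt.preimage_mem_nhds
    (ball_mem_nhds ((ContinuousMap.mk f' hf').comp u) hc0))
  -- Continuity of `v ↦ f' ∘ v` in the sup norm supplies the uniformity: shift `u` by the constant
  -- `y - u s` and evaluate at `s`.
  have key : ∀ s : K, ∀ y ∈ ball (u s) δ, ‖f' y - f' (u s)‖ ≤ c := by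
    intro s y hy
    have hv : dist (u + ContinuousMap.const K (y - u s)) u < δ := by
      rw [dist_eq_norm, add_sub_cancel_left]
      refine lt_of_le_of_lt (
        (ContinuousMap.norm_le (f := ContinuousMap.const K (y - u s)) (norm_nonneg (y - u s))).2 ?_)
        (mem_ball_iff_norm.1 hy)
      intro; simp
    have h1 := H (mem_ball.2 hv)
    rw [mem_preimage, mem_ball] at h1
    have h2 := (ContinuousMap.dist_apply_le_dist s).trans h1.le
    rw [dist_eq_norm] at h2
    simpa using h2
  filter_upwards [ball_mem_nhds u hδ] with v hv
  rw [ContinuousMap.norm_le _ (by positivity)]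
  intro s
  have hs : v s ∈ ball (u s) δ := lt_of_le_of_lt (ContinuousMap.dist_apply_le_dist s) hv
  have h3 := (convex_ball (u s) δ).norm_image_sub_le_of_norm_hasFDerivWithin_le'
    (fun y _ => (hf y).hasFDerivWithinAt) (key s) (mem_ball_self hδ) hs
  refine h3.trans (mul_le_mul_of_nonneg_left ?_ hc0.le)
  exact (v - u).norm_coe_le_norm s

/-- The derivative is again a composition operator, for `fderiv ℝ f`, followed by the linear map
`applyCLM`. So induction on `m` works once `F` varies, and a common universe for `E` and `F` keeps
`E →L[ℝ] F` in range. -/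
theorem ContinuousMap.contDiff_nat_comp_left {E : Type u} [NormedAddCommGroup E] [NormedSpace ℝ E]
    (m : ℕ) : ∀ {F : Type u} [NormedAddCommGroup F] [NormedSpace ℝ F]
    (f : C(E, F)), ContDiff ℝ ∞ f → ContDiff ℝ m (fun v : C(K, E) => f.comp v) := by
  induction m with
  | zero =>
    intro F _ _ f _
    exact contDiff_zero.2 (ContinuousMap.continuous_postcomp _)
  | succ m ih =>
    intro F _ _ f hf
    have hd : ContDiff ℝ ∞ (fderiv ℝ f) := hf.fderiv_right (by simp)
    have h1 := fun u : C(K, E) => ContinuousMap.hasFDerivAt_comp_left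
      (fun x => (hf.differentiable (by simp) x).hasFDerivAt) f.continuous hd.continuous u
    push_cast
    rw [contDiff_succ_iff_fderiv]
    refine ⟨fun u => (h1 u).differentiableAt, by simp, ?_⟩
    have h2 := ih ⟨fderiv ℝ f, hd.continuous⟩ hd
    have h3 := ContinuousMap.applyCLM.contDiff.comp h2
    convert h3 using 1
    funext u
    exact (h1 u).fderiv

theorem ContinuousMap.contDiff_comp_left {E F : Type u} [NormedAddCommGroup E] [NormedSpace ℝ E]
    [NormedAddCommGroup F] [NormedSpace ℝ F] (f : C(E, F)) (hf : ContDiff ℝ ∞ f) :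
    ContDiff ℝ ∞ (fun v : C(K, E) => f.comp v) :=
  contDiff_infty.2 fun m => ContinuousMap.contDiff_nat_comp_left m f hf

end Nemytskii

/-! ### Integration of paths and a local inverse theorem -/

section Integral

variable {E : Type*} [NormedAddCommGroup E] [NormedSpace ℝ E]

omit [NormedSpace ℝ E] in
theorem ContinuousMap.continuous_iccExtend (u : C(Icc (0 : ℝ) 1, E)) :
    Continuous (IccExtend zero_le_one u) := u.continuous.Icc_extend'

/-- The operator `u ↦ (s ↦ ∫ r in 0..s, u r)` on continuous paths. -/
noncomputable def ContinuousMap.primitiveCLM : C(Icc (0 : ℝ) 1, E) →L[ℝ] C(Icc (0 : ℝ) 1, E) :=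
  LinearMap.mkContinuous
    { toFun := fun u => ⟨fun s => ∫ r in (0 : ℝ)..s, IccExtend zero_le_one u r,
        (intervalIntegral.continuous_primitive
          (fun a b => u.continuous_iccExtend.intervalIntegrable a b) 0).comp
          continuous_subtype_val⟩
      map_add' := fun u v => by
        ext s
        exact intervalIntegral.integral_add (u.continuous_iccExtend.intervalIntegrable _ _)
          (v.continuous_iccExtend.intervalIntegrable _ _)
      map_smul' := fun a u => by
        ext s
        exact intervalIntegral.integral_smul a _ } 1
    (fun u => by
      rw [ContinuousMap.norm_le _ (by positivity)]
      intro s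
      have h := intervalIntegral.norm_integral_le_of_norm_le_const (a := (0 : ℝ)) (b := s)
        (f := IccExtend zero_le_one u) (C := ‖u‖) (fun r _ => u.norm_coe_le_norm _)
      refine h.trans ?_
      rw [one_mul]
      refine mul_le_of_le_one_right (norm_nonneg _) ?_
      rw [sub_zero, abs_of_nonneg s.2.1]
      exact s.2.2)

theorem ContinuousMap.primitiveCLM_apply (u : C(Icc (0 : ℝ) 1, E)) (s : Icc (0 : ℝ) 1) :
    ContinuousMap.primitiveCLM u s = ∫ r in (0 : ℝ)..s, IccExtend zero_le_one u r := rfl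

end Integral

/-- Invertible derivatives form an open set, so shrinking the source to points with invertible
derivative makes the inverse smooth on the whole target, not only at `f a`. -/
theorem exists_openPartialHomeomorph_contDiffOn_symm
    {E : Type*} [NormedAddCommGroup E] [NormedSpace ℝ E] [CompleteSpace E]
    {F : Type*} [NormedAddCommGroup F] [NormedSpace ℝ F]
    {f : E → F} {U : Set E} (hU : IsOpen U) (hf : ContDiffOn ℝ ∞ f U) {a : E} (ha : a ∈ U)
    {L : E ≃L[ℝ] F} (hL : HasFDerivAt f (L : E →L[ℝ] F) a) :
    ∃ e : OpenPartialHomeomorph E F, (∀ x, e x = f x) ∧ a ∈ e.source ∧ e.source ⊆ U ∧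
      ContDiffOn ℝ ∞ e.symm e.target := by
  have hfa : ContDiffAt ℝ ∞ f a := hf.contDiffAt (hU.mem_nhds ha)
  set V : Set E := U ∩ fderiv ℝ f ⁻¹' range ((↑) : (E ≃L[ℝ] F) → E →L[ℝ] F)
  have hVo : IsOpen V :=
    (hf.continuousOn_fderiv_of_isOpen hU (by simp)).isOpen_inter_preimage hU
      ContinuousLinearEquiv.isOpen
  set e := (hfa.toOpenPartialHomeomorph f hL (by simp)).restrOpen V hVo with he
  have hes : e.source ⊆ V := by
    rw [he, OpenPartialHomeomorph.restrOpen_source]; exact inter_subset_right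
  refine ⟨e, fun x => rfl, ?_, hes.trans inter_subset_left, ?_⟩
  · rw [he, OpenPartialHomeomorph.restrOpen_source]
    exact ⟨hfa.mem_toOpenPartialHomeomorph_source hL (by simp), ha, L, hL.fderiv.symm⟩
  · intro y hy
    have hx := hes (e.map_target hy)
    obtain ⟨L', hL'⟩ := hx.2
    have hcd : ContDiffAt ℝ ∞ f (e.symm y) := hf.contDiffAt (hU.mem_nhds hx.1)
    refine (e.contDiffAt_symm (f₀' := L') hy ?_ hcd).contDiffWithinAt
    rw [hL']
    exact (hcd.differentiableAt (by simp)).hasFDerivAt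

/-! ### Smooth local flows in a vector space -/

section LocalFlow

variable {E : Type u} [NormedAddCommGroup E] [NormedSpace ℝ E]

/-- The constant paths, as a continuous linear map. -/
noncomputable def ContinuousMap.constPathCLM : E →L[ℝ] C(Icc (0 : ℝ) 1, E) where
  toFun x := ContinuousMap.const _ x
  map_add' _ _ := rfl
  map_smul' _ _ := rfl
  cont := ContinuousMap.continuous_const'

/-- The solutions `u` of the rescaled initial value problem `u' = t f(u)`, `u 0 = x` on `[0, 1]` are
the solutions of `picardDefect f (t, u) = (t, x)`. -/
noncomputable def picardDefect (f : C(E, E)) (p : ℝ × C(Icc (0 : ℝ) 1, E)) :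
    ℝ × C(Icc (0 : ℝ) 1, E) :=
  (p.1, p.2 - p.1 • ContinuousMap.primitiveCLM (f.comp p.2))

theorem contDiff_picardDefect {f : C(E, E)} (hf : ContDiff ℝ ∞ f) :
    ContDiff ℝ ∞ (picardDefect f) :=
  contDiff_fst.prodMk (contDiff_snd.sub (contDiff_fst.smul
    (ContinuousMap.primitiveCLM.contDiff.comp
      ((ContinuousMap.contDiff_comp_left f hf).comp contDiff_snd))))

/-- The shear `(t, u) ↦ (t, u - t • c)`. -/
noncomputable def shearCLE {V : Type*} [NormedAddCommGroup V] [NormedSpace ℝ V] (c : V) :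
    (ℝ × V) ≃L[ℝ] (ℝ × V) :=
  ContinuousLinearEquiv.equivOfInverse
    ((ContinuousLinearMap.fst ℝ ℝ V).prod
      (ContinuousLinearMap.snd ℝ ℝ V - (ContinuousLinearMap.fst ℝ ℝ V).smulRight c))
    ((ContinuousLinearMap.fst ℝ ℝ V).prod
      (ContinuousLinearMap.snd ℝ ℝ V + (ContinuousLinearMap.fst ℝ ℝ V).smulRight c))
    (fun p => by ext <;> simp) (fun p => by ext <;> simp)

/-- At `t = 0` the factor `t` kills the variation of the integral term in `u`. What remains is a
shear, which is invertible, so the inverse function theorem applies. -/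
theorem hasFDerivAt_picardDefect_zero {f : C(E, E)} (hf : ContDiff ℝ ∞ f)
    (u : C(Icc (0 : ℝ) 1, E)) :
    HasFDerivAt (picardDefect f)
      (shearCLE (ContinuousMap.primitiveCLM (f.comp u)) :
        (ℝ × C(Icc (0 : ℝ) 1, E)) →L[ℝ] (ℝ × C(Icc (0 : ℝ) 1, E))) (0, u) := by
  have hg : ContDiff ℝ ∞ fun p : ℝ × C(Icc (0 : ℝ) 1, E) =>
      ContinuousMap.primitiveCLM (f.comp p.2) :=
    ContinuousMap.primitiveCLM.contDiff.comp
      ((ContinuousMap.contDiff_comp_left f hf).comp contDiff_snd)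
  have h1 := (hg.differentiable (by simp) (0, u)).hasFDerivAt
  have h2 := hasFDerivAt_fst.prodMk (hasFDerivAt_snd.sub ((hasFDerivAt_fst (𝕜 := ℝ)
    (p := ((0 : ℝ), u))).smul h1))
  convert! h2 using 1
  ext p <;> simp [shearCLE]

theorem picardDefect_eq {f : C(E, E)} [CompleteSpace E] {α : ℝ → E} {t ε : ℝ}
    (ht : t ∈ Ioo (-ε) ε) (hα : ∀ τ ∈ Ioo (-ε) ε, HasDerivAt α (f (α τ)) τ)
    {u : C(Icc (0 : ℝ) 1, E)} (hu : ∀ s, u s = α (t * s)) :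
    picardDefect f (t, u) = (t, ContinuousMap.constPathCLM (α 0)) := by
  refine Prod.ext rfl (ContinuousMap.ext fun s => ?_)
  have hmem : ∀ r ∈ Icc (0 : ℝ) 1, t * r ∈ Ioo (-ε) ε := by
    intro r hr
    rw [mem_Ioo, ← abs_lt] at ht ⊢
    rw [abs_mul, abs_of_nonneg hr.1]
    exact lt_of_le_of_lt (mul_le_of_le_one_right (abs_nonneg t) hr.2) ht
  have hd : ∀ r ∈ Icc (0 : ℝ) 1, HasDerivAt (fun r => α (t * r)) (t • f (α (t * r))) r := by
    intro r hr
    have h := (hα _ (hmem r hr)).scomp r ((hasDerivAt_id r).const_mul t)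
    simpa [Function.comp_def] using h
  have hsub : uIcc (0 : ℝ) s ⊆ Icc 0 1 := by
    rw [uIcc_of_le s.2.1]
    exact Icc_subset_Icc_right s.2.2
  have hc : ContinuousOn (fun r => t • f (α (t * r))) (uIcc (0 : ℝ) s) :=
    continuousOn_const.smul (f.continuous.comp_continuousOn
      fun r hr => (hd r (hsub hr)).continuousAt.continuousWithinAt)
  have hi := intervalIntegral.integral_eq_sub_of_hasDerivAt
    (fun r hr => hd r (hsub hr)) hc.intervalIntegrable
  have hJ : ContinuousMap.primitiveCLM (f.comp u) s = ∫ r in (0 : ℝ)..s, f (α (t * r)) := by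
    rw [ContinuousMap.primitiveCLM_apply]
    refine intervalIntegral.integral_congr fun r hr => ?_
    change IccExtend zero_le_one (f.comp u) r = _
    rw [IccExtend_of_mem zero_le_one _ (hsub hr)]
    simp [hu]
  rw [intervalIntegral.integral_smul, ← hJ] at hi
  change u s - t • ContinuousMap.primitiveCLM (f.comp u) s = α 0
  rw [hi, hu]
  simp

/-- Picard–Lindelöf gives a continuous flow `α`. Its rescaled orbits `s ↦ α (x, t * s)` are sent by
`picardDefect` to `(t, x)`, so the smooth local inverse recovers them, and evaluation at `s = 1`
shows `α` to be smooth. -/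
theorem ContDiff.exists_contDiffAt_localFlow [CompleteSpace E] {f : E → E} (hf : ContDiff ℝ ∞ f)
    (z : E) : ∃ F : ℝ × E → E, F (0, z) = z ∧ ∀ᶠ p in 𝓝 ((0 : ℝ), z),
      ContDiffAt ℝ ∞ F p ∧ F (0, p.2) = p.2 ∧ HasDerivAt (fun τ => F (τ, p.2)) (f (F p)) p.1 := by
  set g : C(E, E) := ⟨f, hf.continuous⟩
  have hg : ContDiff ℝ ∞ g := hf
  obtain ⟨ε, hε, a, r, L, K, hr, hpl⟩ :=
    IsPicardLindelof.of_contDiffAt_one ((hf.of_le (by simp)).contDiffAt (x := z))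
  obtain ⟨α, hα, hαc⟩ := (hpl 0).exists_forall_mem_closedBall_eq_hasDerivWithinAt_continuousOn
  simp only [zero_sub, zero_add] at hα hαc
  have hαd : ∀ x ∈ closedBall z r, ∀ t ∈ Ioo (-ε) ε,
      HasDerivAt (fun t => α (x, t)) (f (α (x, t))) t := fun x hx t ht =>
    ((hα x hx).2 t (Ioo_subset_Icc_self ht)).hasDerivAt (Icc_mem_nhds ht.1 ht.2)
  obtain ⟨e, he, hes, -, hsm⟩ := exists_openPartialHomeomorph_contDiffOn_symm isOpen_univ
    (contDiff_picardDefect hg).contDiffOn (mem_univ _)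
    (hasFDerivAt_picardDefect_zero hg (ContinuousMap.constPathCLM z))
  obtain ⟨δ, hδ, hball⟩ := Metric.isOpen_iff.1 e.open_source _ hes
  have hz : α (z, 0) = z := (hα z (mem_closedBall_self r.2)).1
  have hαz : ContinuousAt α (z, 0) := hαc.continuousAt
    (prod_mem_nhds (closedBall_mem_nhds z hr) (Icc_mem_nhds (by linarith) hε))
  -- Pointwise bounds give only a non-strict bound on the sup distance; `δ / 2` leaves room for the
  -- strict one.
  obtain ⟨η, hη, hηα⟩ := Metric.continuousAt_iff.1 hαz (δ / 2) (by positivity)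
  rw [hz] at hηα
  set V : Set (ℝ × E) := Ioo (-(min ε (min η δ))) (min ε (min η δ)) ×ˢ ball z (min r η)
  have hVo : IsOpen V := isOpen_Ioo.prod isOpen_ball
  have hm : 0 < min ε (min η δ) := by positivity
  have hzV : ((0 : ℝ), z) ∈ V := ⟨⟨by linarith, hm⟩, mem_ball_self (lt_min hr hη)⟩
  have hVε : ∀ p ∈ V, p.1 ∈ Ioo (-ε) ε := fun p hp =>
    ⟨by linarith [hp.1.1, min_le_left ε (min η δ)], hp.1.2.trans_le (min_le_left _ _)⟩
  have hVη : ∀ p ∈ V, |p.1| < η := fun p hp =>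
    (abs_lt.2 hp.1).trans_le ((min_le_right _ _).trans (min_le_left _ _))
  have hVδ : ∀ p ∈ V, |p.1| < δ := fun p hp =>
    (abs_lt.2 hp.1).trans_le ((min_le_right _ _).trans (min_le_right _ _))
  have hVr : ∀ p ∈ V, p.2 ∈ closedBall z r := fun p hp =>
    ball_subset_closedBall (ball_subset_ball (min_le_left _ _) hp.2)
  have key : ∀ p ∈ V, (p.1, ContinuousMap.constPathCLM p.2) ∈ e.target ∧
      (e.symm (p.1, ContinuousMap.constPathCLM p.2)).2 ⟨1, by simp⟩ = α (p.2, p.1) := by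
    intro p hp
    have hmem : ∀ s : Icc (0 : ℝ) 1, |p.1 * s| ≤ |p.1| := fun s => by
      rw [abs_mul, abs_of_nonneg s.2.1]
      exact mul_le_of_le_one_right (abs_nonneg _) s.2.2
    have hcont : Continuous fun s : Icc (0 : ℝ) 1 => α (p.2, p.1 * s) := by
      refine hαc.comp_continuous (by fun_prop) fun s => ⟨hVr p hp, ?_⟩
      exact abs_le.1 ((hmem s).trans (abs_lt.2 (hVε p hp)).le)
    set u : C(Icc (0 : ℝ) 1, E) := ⟨_, hcont⟩ with hu
    -- The inverse returns this path only if it lies in the source of `e`, hence the closeness to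
    -- the constant path at `z`.
    have hsrc : (p.1, u) ∈ e.source := by
      refine hball ?_
      rw [mem_ball, Prod.dist_eq]
      refine max_lt (by simpa using hVδ p hp) ?_
      refine lt_of_le_of_lt ((ContinuousMap.dist_le (half_pos hδ).le).2 fun s => ?_)
        (half_lt_self hδ)
      refine (hηα ?_).le
      rw [Prod.dist_eq]
      refine max_lt ?_ ?_
      · exact (mem_ball.1 hp.2).trans_le (min_le_right _ _)
      · rw [dist_zero_right]
        exact (hmem s).trans_lt (hVη p hp)
    have heq : e (p.1, u) = (p.1, ContinuousMap.constPathCLM p.2) := by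
      rw [he, picardDefect_eq (hVε p hp) (hαd p.2 (hVr p hp)) (fun s => rfl),
        (hα p.2 (hVr p hp)).1]
    refine ⟨heq ▸ e.map_source hsrc, ?_⟩
    rw [← heq, e.left_inv hsrc]
    simp [hu]
  refine ⟨fun p => (e.symm (p.1, ContinuousMap.constPathCLM p.2)).2 ⟨1, by simp⟩, ?_, ?_⟩
  · exact (key _ hzV).2.trans hz
  · filter_upwards [hVo.mem_nhds hzV] with p hp
    have h0 : ((0 : ℝ), p.2) ∈ V := ⟨hzV.1, hp.2⟩
    refine ⟨?_, ?_, ?_⟩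
    · have h1 : ContDiffAt ℝ ∞ e.symm (p.1, ContinuousMap.constPathCLM p.2) :=
        hsm.contDiffAt (e.open_target.mem_nhds (key p hp).1)
      have h2 : ContDiffAt ℝ ∞ (fun p : ℝ × E => (p.1, ContinuousMap.constPathCLM p.2)) p :=
        contDiffAt_fst.prodMk (ContinuousMap.constPathCLM.contDiff.contDiffAt.comp p contDiffAt_snd)
      have h3 := contDiffAt_snd.comp p (h1.comp p h2)
      exact (ContinuousMap.evalCLM ℝ (⟨1, by simp⟩ : Icc (0 : ℝ) 1)).contDiff.contDiffAt.comp p h3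
    · exact (key _ h0).2.trans (hα _ (hVr p hp)).1
    · have h1 := hαd p.2 (hVr p hp) p.1 (hVε p hp)
      rw [← (key p hp).2] at h1
      refine h1.congr_of_eventuallyEq ?_
      filter_upwards [isOpen_Ioo.mem_nhds hp.1] with τ hτ
      exact (key (τ, p.2) ⟨hτ, hp.2⟩).2

/-- A bump function extends the field smoothly to all of `E`. By continuity, short orbits starting
near `z` stay where the bump equals `1`, so they solve the original equation. -/
theorem ContDiffOn.exists_contDiffOn_localFlow [FiniteDimensional ℝ E] {f : E → E} {U : Set E}
    (hU : IsOpen U) (hf : ContDiffOn ℝ ∞ f U) {z : E} (hz : z ∈ U) :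
    ∃ ε > 0, ∃ W : Set E, IsOpen W ∧ z ∈ W ∧ W ⊆ U ∧ ∃ F : ℝ × E → E,
      ContDiffOn ℝ ∞ F (Ioo (-ε) ε ×ˢ W) ∧ (∀ w ∈ W, F (0, w) = w) ∧
      ∀ w ∈ W, ∀ t ∈ Ioo (-ε) ε, F (t, w) ∈ U ∧
        HasDerivAt (fun τ => F (τ, w)) (f (F (t, w))) t := by
  have := FiniteDimensional.complete ℝ E
  obtain ⟨χ, hχU, hχ, hχz⟩ :
      ∃ χ : E → ℝ, tsupport χ ⊆ U ∧ ContDiff ℝ ∞ χ ∧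
        ∀ᶠ x in 𝓝 z, χ x = 1 := by
    obtain ⟨R, hR, hball⟩ := Metric.nhds_basis_closedBall.mem_iff.1 (hU.mem_nhds hz)
    let b : ContDiffBump z := ⟨R / 2, R, by positivity, by linarith⟩
    exact ⟨b, b.tsupport_eq.trans_subset hball, b.contDiff,
      b.eventuallyEq_one⟩
  have hg : ContDiff ℝ ∞ fun x => χ x • f x := by
    rw [contDiff_iff_contDiffAt]
    intro x
    by_cases hx : x ∈ tsupport χ
    · exact hχ.contDiffAt.smul (hf.contDiffAt (hU.mem_nhds (hχU hx)))
    · refine (contDiffAt_const (c := (0 : E))).congr_of_eventuallyEq ?_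
      filter_upwards [(isClosed_tsupport χ).isOpen_compl.mem_nhds hx] with y hy
      rw [image_eq_zero_of_notMem_tsupport hy, zero_smul]
  obtain ⟨F, hFz, hF⟩ := hg.exists_contDiffAt_localFlow z
  have hFc : ContinuousAt F (0, z) := hF.self_of_nhds.1.continuousAt
  have hFt : Tendsto F (𝓝 (0, z)) (𝓝 z) := by simpa only [hFz] using hFc.tendsto
  have hev := hF.and (hFt.eventually (hχz.and (hU.mem_nhds hz)))
  rw [nhds_prod_eq, ((nhds_basis_Ioo_pos (0 : ℝ)).prod (nhds_basis_opens z)).eventually_iff] at hev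
  obtain ⟨⟨ε, W⟩, ⟨hε, hzW, hWo⟩, H⟩ := hev
  simp only [zero_sub, zero_add] at H
  refine ⟨ε, hε, W ∩ U, hWo.inter hU, ⟨hzW, hz⟩, inter_subset_right, F, ?_, ?_, ?_⟩
  · exact fun p hp => (H ⟨hp.1, hp.2.1⟩).1.1.contDiffWithinAt
  · intro w hw
    exact (H (x := (0, w)) ⟨⟨by simpa using hε, hε⟩, hw.1⟩).1.2.1
  · intro w hw t ht
    have h := H (x := (t, w)) ⟨ht, hw.1⟩
    refine ⟨h.2.2, ?_⟩
    have h2 := h.1.2.2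
    rwa [h.2.1, one_smul] at h2

end LocalFlow

/-! ### Transitions between charts -/

namespace OrbifoldAtlas

namespace VectorField

variable {n : ℕ} {X : Type*} [TopologicalSpace X] {A : OrbifoldAtlas n X}

/-- A smooth map `T` from the open subset `W` of the chart `c` to the chart `d` that lifts the
identity of `X` and carries the local representative of `v` on `c` to the one on `d`. -/
structure IsTransition (v : A.VectorField) (c d : OrbifoldChart n X)
    (T : EuclideanSpace ℝ (Fin n) → EuclideanSpace ℝ (Fin n))
    (W : Set (EuclideanSpace ℝ (Fin n))) : Prop where
  isOpen : IsOpen W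
  subset : W ⊆ c.dom
  smooth : ContDiffOn ℝ ∞ T W
  mapsTo : ∀ w ∈ W, T w ∈ d.dom
  map_eq : ∀ w ∈ W, d.map (T w) = c.map w
  fderiv_eq : ∀ w ∈ W, fderiv ℝ T w (v.toFun c w) = v.toFun d (T w)

variable {v : A.VectorField} {c d e : OrbifoldChart n X}
  {S T : EuclideanSpace ℝ (Fin n) → EuclideanSpace ℝ (Fin n)}
  {V W : Set (EuclideanSpace ℝ (Fin n))}

theorem IsTransition.hasFDerivAt (h : v.IsTransition c d T W) {w} (hw : w ∈ W) :
    HasFDerivAt T (fderiv ℝ T w) w :=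
  ((h.smooth.contDiffAt (h.isOpen.mem_nhds hw)).differentiableAt (by simp)).hasFDerivAt

theorem IsTransition.comp (hT : v.IsTransition d e T W) (hS : v.IsTransition c d S V) :
    v.IsTransition c e (T ∘ S) (V ∩ S ⁻¹' W) where
  isOpen := hS.smooth.continuousOn.isOpen_inter_preimage hS.isOpen hT.isOpen
  subset := inter_subset_left.trans hS.subset
  smooth := hT.smooth.comp (hS.smooth.mono inter_subset_left) fun _ hw => hw.2
  mapsTo _ hw := hT.mapsTo _ hw.2
  map_eq _ hw := (hT.map_eq _ hw.2).trans (hS.map_eq _ hw.1)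
  fderiv_eq w hw := by
    rw [((hT.hasFDerivAt hw.2).comp w (hS.hasFDerivAt hw.1)).fderiv,
      ContinuousLinearMap.comp_apply, hS.fderiv_eq w hw.1, hT.fderiv_eq _ hw.2]
    rfl

theorem isTransition_act (hc : c ∈ A.charts) (g : c.G) : v.IsTransition c c (c.act g) c.dom where
  isOpen := c.isOpen_dom
  subset := Subset.rfl
  smooth := c.act_smooth g
  mapsTo := c.act_mem g
  map_eq w hw := ((c.map_eq_iff w hw _ (c.act_mem g w hw)).2 ⟨g, rfl⟩).symm
  fderiv_eq := v.invariant c hc g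

/-- An injective endomorphism in finite dimension is invertible, so `l` has a smooth local inverse
and the transition is `m ∘ l⁻¹`. -/
theorem exists_isTransition_of_isChartEmbedding (hc : c ∈ A.charts) (hd : d ∈ A.charts)
    {w : OrbifoldChart n X} {l m : EuclideanSpace ℝ (Fin n) → EuclideanSpace ℝ (Fin n)}
    (hl : w.IsChartEmbedding c l) (hm : w.IsChartEmbedding d m) {p : EuclideanSpace ℝ (Fin n)}
    (hp : p ∈ w.dom) : ∃ T W, v.IsTransition c d T W ∧ l p ∈ W ∧ T (l p) = m p := by
  have hdiff : ∀ {f : EuclideanSpace ℝ (Fin n) → EuclideanSpace ℝ (Fin n)},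
      ContDiffOn ℝ ∞ f w.dom → ∀ q ∈ w.dom, HasFDerivAt f (fderiv ℝ f q) q := fun hf q hq =>
    ((hf.contDiffAt (w.isOpen_dom.mem_nhds hq)).differentiableAt (by simp)).hasFDerivAt
  set L := (LinearEquiv.ofInjectiveEndo (fderiv ℝ l p).toLinearMap
    (hl.immersion p hp)).toContinuousLinearEquiv
  have hL : HasFDerivAt l (L : EuclideanSpace ℝ (Fin n) →L[ℝ] EuclideanSpace ℝ (Fin n)) p := by
    convert! hdiff hl.smooth p hp
  obtain ⟨e, he, hpe, hes, hsm⟩ :=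
    exists_openPartialHomeomorph_contDiffOn_symm w.isOpen_dom hl.smooth hp hL
  have hmem : ∀ y ∈ e.target, e.symm y ∈ w.dom := fun y hy => hes (e.map_target hy)
  have hinv : ∀ y ∈ e.target, l (e.symm y) = y := fun y hy => by rw [← he, e.right_inv hy]
  refine ⟨m ∘ e.symm, e.target, ⟨e.open_target, ?_, ?_, ?_, ?_, ?_⟩, ?_, ?_⟩
  · intro y hy
    exact hinv y hy ▸ hl.mapsTo (hmem y hy)
  · exact hm.smooth.comp hsm hmem
  · exact fun y hy => hm.mapsTo (hmem y hy)
  · intro y hy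
    rw [Function.comp_apply, hm.map_comp _ (hmem y hy), ← hl.map_comp _ (hmem y hy), hinv y hy]
  · intro y hy
    have h1 : HasFDerivAt e.symm (fderiv ℝ e.symm y) y :=
      ((hsm.contDiffAt (e.open_target.mem_nhds hy)).differentiableAt (by simp)).hasFDerivAt
    have h2 := (hdiff hl.smooth _ (hmem y hy)).comp y h1
    have h3 := h2.unique ((hasFDerivAt_id y).congr_of_eventuallyEq
      (by filter_upwards [e.open_target.mem_nhds hy] with x hx using hinv x hx))
    rw [((hdiff hm.smooth _ (hmem y hy)).comp y h1).fderiv, ContinuousLinearMap.comp_apply]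
    -- The pulled-back vector is the image of the field on `c` under the derivative of `l⁻¹`; the
    -- chain rule `h3` verifies this.
    refine v.compatible c hc d hd w l m hl hm _ (hmem y hy) _ ?_
    rw [← ContinuousLinearMap.comp_apply, h3, hinv y hy]
    rfl
  · rw [← he]; exact e.map_source hpe
  · rw [Function.comp_apply, ← he, e.left_inv hpe]

/-- Two points of charts over the same point of `X` are related by a transition. -/
theorem exists_isTransition (v : A.VectorField) (hc : c ∈ A.charts) (hd : d ∈ A.charts)
    {z z' : EuclideanSpace ℝ (Fin n)}
    (hz : z ∈ c.dom) (hz' : z' ∈ d.dom) (h : c.map z = d.map z') :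
    ∃ T W, v.IsTransition c d T W ∧ z ∈ W ∧ T z = z' := by
  obtain ⟨w, l, m, ⟨p, hp, hpx⟩, hl, hm⟩ :=
    A.compatible c hc d hd (c.map z) ⟨⟨z, hz, rfl⟩, z', hz', h.symm⟩
  obtain ⟨T, W, hT, hlW, hTl⟩ := exists_isTransition_of_isChartEmbedding (v := v) hc hd hl hm hp
  -- The common chart gives a transition from `l p` to `m p`. These lie over the same point as `z`
  -- and `z'`, so group elements on either side correct the endpoints.
  obtain ⟨g, hg⟩ := (c.map_eq_iff z hz (l p) (hl.mapsTo hp)).1 (by rw [hl.map_comp p hp, hpx])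
  obtain ⟨k, hk⟩ := (d.map_eq_iff (m p) (hm.mapsTo hp) z' hz').1
    (by rw [hm.map_comp p hp, hpx, h])
  refine ⟨_, _, (isTransition_act hd k).comp (hT.comp (isTransition_act hc g)),
    ⟨⟨hz, ?_⟩, ?_⟩, ?_⟩
  · rwa [mem_preimage, hg]
  · rw [mem_preimage, Function.comp_apply, hg, hTl]; exact hm.mapsTo hp
  · rw [Function.comp_apply, Function.comp_apply, hg, hTl, hk]

theorem IsTransition.hasDerivAt_comp (hT : v.IsTransition c d T W)
    {a : ℝ → EuclideanSpace ℝ (Fin n)} {t : ℝ} (ha : HasDerivAt a (v.toFun c (a t)) t)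
    (hW : a t ∈ W) : HasDerivAt (T ∘ a) (v.toFun d (T (a t))) t := by
  rw [← hT.fderiv_eq _ hW]
  exact (hT.hasFDerivAt hW).comp_hasDerivAt t ha

/-! ### Integral curves: lifting and uniqueness -/

/-- `a` is, near `t`, a lift of `γ` to the chart `c` which is an integral curve of `v`. -/
def IsLiftAt (v : A.VectorField) (γ : ℝ → X) (t : ℝ) (c : OrbifoldChart n X)
    (a : ℝ → EuclideanSpace ℝ (Fin n)) : Prop :=
  ∀ᶠ τ in 𝓝 t, a τ ∈ c.dom ∧ c.map (a τ) = γ τ ∧ HasDerivAt a (v.toFun c (a τ)) τ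

/-- Integral curves of a vector field on an orbifold: near every time, they lift to an integral
curve in a chart. -/
def IsIntegralOn (v : A.VectorField) (γ : ℝ → X) (s : Set ℝ) : Prop :=
  ∀ t ∈ s, ∃ c ∈ A.charts, ∃ a, v.IsLiftAt γ t c a

variable {γ γ' : ℝ → X} {s : Set ℝ} {t : ℝ} {a : ℝ → EuclideanSpace ℝ (Fin n)}

theorem IsLiftAt.exists_lift_of_mem (h : v.IsLiftAt γ t c a) (hc : c ∈ A.charts)
    (hd : d ∈ A.charts) {z : EuclideanSpace ℝ (Fin n)} (hz : z ∈ d.dom) (hzt : d.map z = γ t) :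
    ∃ b, v.IsLiftAt γ t d b ∧ b t = z := by
  obtain ⟨h1, h2, h3⟩ := h.self_of_nhds
  obtain ⟨T, W, hT, haW, hTa⟩ := v.exists_isTransition hc hd h1 hz (h2.trans hzt.symm)
  refine ⟨T ∘ a, ?_, hTa⟩
  filter_upwards [h, h3.continuousAt.preimage_mem_nhds (hT.isOpen.mem_nhds haW)] with τ hτ hτW
  exact ⟨hT.mapsTo _ hτW, (hT.map_eq _ hτW).trans hτ.2.1, hT.hasDerivAt_comp hτ.2.2 hτW⟩

theorem IsIntegralOn.exists_lift (h : v.IsIntegralOn γ s) (ht : t ∈ s) (hd : d ∈ A.charts)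
    {z : EuclideanSpace ℝ (Fin n)} (hz : z ∈ d.dom) (hzt : d.map z = γ t) :
    ∃ b, v.IsLiftAt γ t d b ∧ b t = z := by
  obtain ⟨c, hc, a, ha⟩ := h t ht
  exact ha.exists_lift_of_mem hc hd hz hzt

theorem IsLiftAt.continuousAt (h : v.IsLiftAt γ t c a) : ContinuousAt γ t := by
  obtain ⟨h1, h2, h3⟩ := h.self_of_nhds
  have h4 : ContinuousAt (fun τ => c.map (a τ)) t :=
    ContinuousAt.comp (f := a) (c.map_continuousOn.continuousAt (c.isOpen_dom.mem_nhds h1))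
      h3.continuousAt
  exact h4.congr (h.mono fun τ hτ => hτ.2.1)

theorem IsLiftAt.eventuallyEq (hc : c ∈ A.charts) {b : ℝ → EuclideanSpace ℝ (Fin n)}
    (ha : v.IsLiftAt γ t c a) (hb : v.IsLiftAt γ' t c b) (hab : a t = b t) : γ =ᶠ[𝓝 t] γ' := by
  obtain ⟨h1, h2, h3⟩ := ha.self_of_nhds
  obtain ⟨K, S, hS, hK⟩ := (((v.smooth c hc).contDiffAt (c.isOpen_dom.mem_nhds h1)).of_le
    (by simp : (1 : WithTop ℕ∞) ≤ ∞)).exists_lipschitzOnWith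
  have hS' : S ∈ 𝓝 (b t) := hab ▸ hS
  have h := ODE_solution_unique_of_eventually (v := fun _ => v.toFun c) (s := fun _ => S)
    (Eventually.of_forall fun _ => hK)
    ((ha.mono fun τ hτ => hτ.2.2).and (h3.continuousAt.preimage_mem_nhds hS))
    ((hb.mono fun τ hτ => hτ.2.2).and
      (hb.self_of_nhds.2.2.continuousAt.preimage_mem_nhds hS')) hab
  filter_upwards [h, ha, hb] with τ h4 h5 h6
  rw [← h5.2.1, ← h6.2.1, h4]

theorem IsIntegralOn.eventuallyEq (h : v.IsIntegralOn γ s) (h' : v.IsIntegralOn γ' s)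
    (ht : t ∈ s) (heq : γ t = γ' t) : γ =ᶠ[𝓝 t] γ' := by
  obtain ⟨c, hc, a, ha⟩ := h t ht
  obtain ⟨h1, h2, h3⟩ := ha.self_of_nhds
  obtain ⟨b, hb, hbt⟩ := h'.exists_lift ht hc h1 (h2.trans heq)
  exact ha.eventuallyEq hc hb hbt.symm

/-- Agreement at a time propagates to a neighbourhood by local uniqueness; disagreement does so by
continuity and the Hausdorff property. A preconnected set cannot meet both open sets. -/
theorem IsIntegralOn.eqOn [T2Space X] (h : v.IsIntegralOn γ s) (h' : v.IsIntegralOn γ' s)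
    (hs : IsPreconnected s) (ht : t ∈ s) (heq : γ t = γ' t) : EqOn γ γ' s := by
  have hcont : ∀ {δ : ℝ → X}, v.IsIntegralOn δ s → ∀ τ ∈ s, ContinuousAt δ τ := by
    intro δ hδ τ hτ
    obtain ⟨c, -, a, ha⟩ := hδ τ hτ
    exact ha.continuousAt
  by_contra hne
  rw [EqOn] at hne
  push Not at hne
  obtain ⟨r, hr, hrne⟩ := hne
  have hev : ∀ τ ∈ s, γ τ ≠ γ' τ → ∀ᶠ x in 𝓝 τ, γ x ≠ γ' x := fun τ hτ hτne =>
    (hcont h τ hτ).ne_iff_eventually_ne (hcont h' τ hτ) |>.1 hτne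
  obtain ⟨q, hq, hq1, hq2⟩ := hs {x | ∀ᶠ y in 𝓝 x, γ y = γ' y} {x | ∀ᶠ y in 𝓝 x, γ y ≠ γ' y}
    isOpen_setOfPred_eventually_nhds isOpen_setOfPred_eventually_nhds
    (fun τ hτ => by
      by_cases hτeq : γ τ = γ' τ
      · exact Or.inl (h.eventuallyEq h' hτ hτeq)
      · exact Or.inr (hev τ hτ hτeq))
    ⟨t, ht, h.eventuallyEq h' ht heq⟩ ⟨r, hr, hev r hr hrne⟩
  exact hq2.self_of_nhds hq1.self_of_nhds

theorem IsIntegralOn.mono {s' : Set ℝ} (h : v.IsIntegralOn γ s) (hs : s' ⊆ s) :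
    v.IsIntegralOn γ s' := fun t ht => h t (hs ht)

theorem IsIntegralOn.congr (h : v.IsIntegralOn γ s) (hs : IsOpen s) (heq : EqOn γ' γ s) :
    v.IsIntegralOn γ' s := by
  intro t ht
  obtain ⟨c, hc, a, ha⟩ := h t ht
  refine ⟨c, hc, a, ?_⟩
  filter_upwards [ha, hs.mem_nhds ht] with τ hτ hτs
  exact ⟨hτ.1, hτ.2.1.trans (heq hτs).symm, hτ.2.2⟩

theorem IsIntegralOn.comp_add (h : v.IsIntegralOn γ s) (r : ℝ) :
    v.IsIntegralOn (fun t => γ (t + r)) ((· + r) ⁻¹' s) := by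
  intro t ht
  obtain ⟨c, hc, a, ha⟩ := h (t + r) ht
  refine ⟨c, hc, fun τ => a (τ + r), ?_⟩
  have hlim : Tendsto (· + r) (𝓝 t) (𝓝 (t + r)) := (continuous_id.add continuous_const).tendsto t
  filter_upwards [hlim.eventually ha] with τ hτ
  exact ⟨hτ.1, hτ.2.1, hτ.2.2.comp_add_const τ r⟩

end VectorField

end OrbifoldAtlas

namespace OrbifoldAtlas

section SmoothMap

variable {n m k : ℕ} {X Y Z : Type*} [TopologicalSpace X] [TopologicalSpace Y] [TopologicalSpace Z]
  {A : OrbifoldAtlas n X} {B : OrbifoldAtlas m Y} {C : OrbifoldAtlas k Z}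

theorem isSmoothMap_id (A : OrbifoldAtlas n X) : A.IsSmoothMap A id := fun c hc _ hz =>
  ⟨c, hc, c.dom, id, c.isOpen_dom, hz, Subset.rfl, contDiffOn_id, fun _ hw => ⟨hw, rfl⟩⟩

theorem IsSmoothMap.comp {g : Y → Z} {f : X → Y} (hg : B.IsSmoothMap C g)
    (hf : A.IsSmoothMap B f) : A.IsSmoothMap C (g ∘ f) := by
  intro c hc z hz
  obtain ⟨d, hd, W, F, hW, hzW, hWc, hF, hFd⟩ := hf c hc z hz
  obtain ⟨e, he, W', F', hW', hzW', -, hF', hFe⟩ := hg d hd (F z) (hFd z hzW).1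
  refine ⟨e, he, W ∩ F ⁻¹' W', F' ∘ F, hF.continuousOn.isOpen_inter_preimage hW hW',
    ⟨hzW, hzW'⟩, inter_subset_left.trans hWc,
    hF'.comp (hF.mono inter_subset_left) fun _ hw => hw.2, fun w hw => ?_⟩
  refine ⟨(hFe _ hw.2).1, ?_⟩
  rw [Function.comp_apply, (hFe _ hw.2).2, (hFd _ hw.1).2, Function.comp_apply]

end SmoothMap

/-! ### Uniform local flows and completeness -/

namespace VectorField

variable {n : ℕ} {X : Type*} [TopologicalSpace X] {A : OrbifoldAtlas n X} {v : A.VectorField}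
  {c d : OrbifoldChart n X} {z : EuclideanSpace ℝ (Fin n)} {ε : ℝ}

/-- Near the point `z` of the chart `c`, the flow of `v` is defined for times in `(-ε, ε)` and
lifts to a smooth map with values in a chart. -/
def HasLocalFlow (v : A.VectorField) (ε : ℝ) (c : OrbifoldChart n X)
    (z : EuclideanSpace ℝ (Fin n)) : Prop :=
  ∃ d ∈ A.charts, ∃ (W : Set (EuclideanSpace ℝ (Fin n)))
    (F : ℝ × EuclideanSpace ℝ (Fin n) → EuclideanSpace ℝ (Fin n)),
    IsOpen W ∧ z ∈ W ∧ W ⊆ c.dom ∧ ContDiffOn ℝ ∞ F (Ioo (-ε) ε ×ˢ W) ∧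
      ∀ w ∈ W, d.map (F (0, w)) = c.map w ∧ ∀ t ∈ Ioo (-ε) ε, F (t, w) ∈ d.dom ∧
        HasDerivAt (fun τ => F (τ, w)) (v.toFun d (F (t, w))) t

theorem HasLocalFlow.mono {ε' : ℝ} (h : v.HasLocalFlow ε c z) (hε : ε' ≤ ε) :
    v.HasLocalFlow ε' c z := by
  obtain ⟨d, hd, W, F, hW, hzW, hWc, hF, H⟩ := h
  have hI : Ioo (-ε') ε' ⊆ Ioo (-ε) ε := Ioo_subset_Ioo (by linarith) hε
  exact ⟨d, hd, W, F, hW, hzW, hWc, hF.mono (prod_mono hI Subset.rfl),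
    fun w hw => ⟨(H w hw).1, fun t ht => (H w hw).2 t (hI ht)⟩⟩

/-- One local flow near a single preimage of `x` suffices: precomposing it with a transition serves
every chart point over the neighbourhood, with the same `ε`. -/
theorem exists_nhds_hasLocalFlow (v : A.VectorField) (x : X) :
    ∃ ε > 0, ∃ V ∈ 𝓝 x, ∀ c ∈ A.charts, ∀ z ∈ c.dom, c.map z ∈ V → v.HasLocalFlow ε c z := by
  obtain ⟨d, hd, z₀, hz₀, rfl⟩ := A.cover x
  obtain ⟨ε, hε, W, hW, hzW, hWd, F, hF, hF0, H⟩ :=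
    (v.smooth d hd).exists_contDiffOn_localFlow d.isOpen_dom hz₀
  refine ⟨ε, hε, d.map '' W, (d.map_isOpen W hWd hW).mem_nhds ⟨z₀, hzW, rfl⟩, ?_⟩
  rintro c hc z hz ⟨z', hz', hzz'⟩
  obtain ⟨T, V, hT, hzV, hTz⟩ := v.exists_isTransition hc hd hz (hWd hz') hzz'.symm
  refine ⟨d, hd, V ∩ T ⁻¹' W, fun p => F (p.1, T p.2),
    hT.smooth.continuousOn.isOpen_inter_preimage hT.isOpen hW,
    ⟨hzV, by rwa [mem_preimage, hTz]⟩, inter_subset_left.trans hT.subset, ?_, ?_⟩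
  · exact hF.comp (contDiff_fst.contDiffOn.prodMk (hT.smooth.comp contDiff_snd.contDiffOn
      fun p hp => hp.2.1)) fun p hp => ⟨hp.1, hp.2.2⟩
  · intro w hw
    exact ⟨by simp only [hF0 _ hw.2, hT.map_eq w hw.1], H (T w) hw.2⟩

theorem exists_forall_hasLocalFlow [CompactSpace X] (v : A.VectorField) :
    ∃ ε > 0, ∀ c ∈ A.charts, ∀ z ∈ c.dom, v.HasLocalFlow ε c z := by
  suffices h : ∃ ε > 0, ∀ c ∈ A.charts, ∀ z ∈ c.dom, c.map z ∈ (univ : Set X) →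
      v.HasLocalFlow ε c z by simpa using h
  refine isCompact_univ.induction_on (p := fun S : Set X => ∃ ε > 0, ∀ c ∈ A.charts, ∀ z ∈ c.dom,
    c.map z ∈ S → v.HasLocalFlow ε c z) ⟨1, one_pos, by simp⟩ ?_ ?_ ?_
  · rintro S S' hS ⟨ε, hε, h⟩
    exact ⟨ε, hε, fun c hc z hz hzS => h c hc z hz (hS hzS)⟩
  · rintro S S' ⟨ε, hε, h⟩ ⟨ε', hε', h'⟩
    refine ⟨min ε ε', lt_min hε hε', fun c hc z hz hzS => hzS.elim (fun h1 => ?_) fun h1 => ?_⟩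
    · exact (h c hc z hz h1).mono (min_le_left _ _)
    · exact (h' c hc z hz h1).mono (min_le_right _ _)
  · intro x _
    obtain ⟨ε, hε, V, hV, h⟩ := v.exists_nhds_hasLocalFlow x
    exact ⟨V, mem_nhdsWithin_of_mem_nhds hV, ε, hε, h⟩

theorem isIntegralOn_of_hasDerivAt (hd : d ∈ A.charts) {a : ℝ → EuclideanSpace ℝ (Fin n)}
    {s : Set ℝ} (hs : IsOpen s)
    (h : ∀ t ∈ s, a t ∈ d.dom ∧ HasDerivAt a (v.toFun d (a t)) t) :
    v.IsIntegralOn (fun t => d.map (a t)) s := by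
  intro t ht
  refine ⟨d, hd, a, ?_⟩
  filter_upwards [hs.mem_nhds ht] with τ hτ
  exact ⟨(h τ hτ).1, rfl, (h τ hτ).2⟩

theorem exists_isIntegralOn_of_hasLocalFlow
    (h : ∀ c ∈ A.charts, ∀ z ∈ c.dom, v.HasLocalFlow ε c z) (x : X) :
    ∃ γ : ℝ → X, γ 0 = x ∧ v.IsIntegralOn γ (Ioo (-ε) ε) := by
  obtain ⟨c, hc, z, hz, rfl⟩ := A.cover x
  obtain ⟨d, hd, W, F, -, hzW, -, -, H⟩ := h c hc z hz
  exact ⟨_, (H z hzW).1, isIntegralOn_of_hasDerivAt hd isOpen_Ioo (H z hzW).2⟩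

variable [T2Space X]

theorem IsIntegralOn.add_eq {Ψ : X → ℝ → X} {a : ℝ} (h0 : ∀ x, Ψ x 0 = x)
    (h : ∀ x, v.IsIntegralOn (Ψ x) (Ioo (-a) a)) (x : X) {s t : ℝ} (hs : s ∈ Ioo (-a) a)
    (ht : t ∈ Ioo (-a) a) (hst : s + t ∈ Ioo (-a) a) : Ψ x (s + t) = Ψ (Ψ x t) s := by
  have hconn : IsPreconnected (Ioo (-a) a ∩ (· + t) ⁻¹' Ioo (-a) a) :=
    (ordConnected_Ioo.inter (ordConnected_Ioo.preimage_mono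
      fun _ _ h => add_le_add_left h t)).isPreconnected
  have ha : 0 < a := by linarith [hs.1, hs.2]
  exact (((h x).comp_add t).mono inter_subset_right).eqOn ((h (Ψ x t)).mono inter_subset_left)
    hconn (t := 0) ⟨⟨by linarith, ha⟩, by simpa using ht⟩ (by simp [h0]) ⟨hs, hst⟩

/-- Flowing twice for time `t / 2` reaches time `t`. Near `t₀` this agrees with flowing for `t₀ / 2`
and then for `t - t₀ / 2`, which is a time translate of a single integral curve in `t`. -/
theorem exists_isIntegralOn_two_mul {a : ℝ}
    (h : ∀ x : X, ∃ γ : ℝ → X, γ 0 = x ∧ v.IsIntegralOn γ (Ioo (-a) a)) (x : X) :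
    ∃ γ : ℝ → X, γ 0 = x ∧ v.IsIntegralOn γ (Ioo (-(2 * a)) (2 * a)) := by
  choose Ψ h0 hΨ using h
  refine ⟨fun t => Ψ (Ψ x (t / 2)) (t / 2), by simp [h0], fun t₀ ht₀ => ?_⟩
  have ht₀' : t₀ / 2 ∈ Ioo (-a) a := ⟨by linarith [ht₀.1], by linarith [ht₀.2]⟩
  have ha : 0 < a := by linarith [ht₀.1, ht₀.2]
  set s : Set ℝ := {t | t / 2 ∈ Ioo (-a) a ∧ (t - t₀) / 2 ∈ Ioo (-a) a ∧ t + -(t₀ / 2) ∈ Ioo (-a) a}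
  have hs : IsOpen s := (isOpen_Ioo.preimage (by fun_prop)).inter
    ((isOpen_Ioo.preimage (by fun_prop)).inter (isOpen_Ioo.preimage (by fun_prop)))
  have ht₀s : t₀ ∈ s := ⟨ht₀', by simpa using ha, by convert ht₀' using 1; ring⟩
  refine (((hΨ (Ψ x (t₀ / 2))).comp_add (-(t₀ / 2))).mono (s' := s) fun t ht => ht.2.2).congr hs
    (fun t ht => ?_) t₀ ht₀s
  obtain ⟨h1, h2, h3⟩ := ht
  have e1 : t / 2 = (t - t₀) / 2 + t₀ / 2 := by ring
  have e2 : t + -(t₀ / 2) = t / 2 + (t - t₀) / 2 := by ring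
  have k1 := IsIntegralOn.add_eq h0 hΨ x h2 ht₀' (e1 ▸ h1)
  have k2 := IsIntegralOn.add_eq h0 hΨ (Ψ x (t₀ / 2)) h1 h2 (e2 ▸ h3)
  rw [← e1] at k1
  rw [← e2] at k2
  beta_reduce
  rw [k1, k2]

theorem exists_isIntegralOn_univ [CompactSpace X] (v : A.VectorField) (x : X) :
    ∃ γ : ℝ → X, γ 0 = x ∧ v.IsIntegralOn γ univ := by
  obtain ⟨ε, hε, hflow⟩ := v.exists_forall_hasLocalFlow
  have hpow : ∀ k : ℕ, ∀ x : X, ∃ γ : ℝ → X, γ 0 = x ∧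
      v.IsIntegralOn γ (Ioo (-(2 ^ k * ε)) (2 ^ k * ε)) := by
    intro k
    induction k with
    | zero => simpa using exists_isIntegralOn_of_hasLocalFlow hflow
    | succ k ih =>
      rw [show (2 : ℝ) ^ (k + 1) * ε = 2 * (2 ^ k * ε) by ring]
      exact exists_isIntegralOn_two_mul ih
  choose γ h0 hγ using fun k => hpow k x
  have hex : ∀ t : ℝ, ∃ k : ℕ, t ∈ Ioo (-(2 ^ k * ε)) (2 ^ k * ε) := by
    intro t
    obtain ⟨k, hk⟩ := pow_unbounded_of_one_lt (|t| / ε) one_lt_two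
    exact ⟨k, abs_lt.1 ((div_lt_iff₀ hε).1 hk)⟩
  choose κ hκ using hex
  have hpos : ∀ k : ℕ, 0 < 2 ^ k * ε := fun k => by positivity
  -- The curves agree on overlaps, so the arbitrary choice of `κ t` is harmless.
  have heq : ∀ k : ℕ, EqOn (fun t => γ (κ t) t) (γ k) (Ioo (-(2 ^ k * ε)) (2 ^ k * ε)) := by
    intro k t ht
    exact ((hγ (κ t)).mono inter_subset_left).eqOn ((hγ k).mono inter_subset_right)
      (ordConnected_Ioo.inter ordConnected_Ioo).isPreconnected (t := 0)
      ⟨⟨by linarith [hpos (κ t)], hpos _⟩, ⟨by linarith [hpos k], hpos _⟩⟩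
      (by rw [h0, h0]) ⟨hκ t, ht⟩
  exact ⟨fun t => γ (κ t) t, h0 _, fun t _ => (hγ (κ t)).congr isOpen_Ioo (heq (κ t)) t (hκ t)⟩

/-! ### The global flow and its smoothness -/

/-- `φ` is the flow of `v`: its orbits are the integral curves of `v`. -/
structure IsFlow (v : A.VectorField) (φ : ℝ → X → X) : Prop where
  map_zero : ∀ x, φ 0 x = x
  isIntegralOn : ∀ x, v.IsIntegralOn (fun t => φ t x) univ

theorem exists_isFlow [CompactSpace X] (v : A.VectorField) :
    ∃ φ, v.IsFlow φ := by
  choose γ h0 hγ using v.exists_isIntegralOn_univ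
  exact ⟨fun t x => γ x t, h0, hγ⟩

variable {φ : ℝ → X → X}

theorem IsFlow.eq_of_isIntegralOn (hφ : v.IsFlow φ) {γ : ℝ → X} {a : ℝ}
    (hγ : v.IsIntegralOn γ (Ioo (-a) a)) {t : ℝ} (ht : t ∈ Ioo (-a) a) : γ t = φ t (γ 0) :=
  hγ.eqOn ((hφ.isIntegralOn (γ 0)).mono (subset_univ _)) isPreconnected_Ioo (t := 0)
    ⟨by linarith [ht.1, ht.2], by linarith [ht.1, ht.2]⟩ (hφ.map_zero _).symm ht

theorem IsFlow.map_add (hφ : v.IsFlow φ) (s t : ℝ) (x : X) : φ (s + t) x = φ s (φ t x) :=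
  ((hφ.isIntegralOn x).comp_add t).eqOn (hφ.isIntegralOn (φ t x)) isPreconnected_univ
    (mem_univ 0) (by simp [hφ.map_zero]) (mem_univ s)

theorem HasLocalFlow.exists_lift (h : v.HasLocalFlow ε c z) (hφ : v.IsFlow φ) :
    ∃ d ∈ A.charts, ∃ (W : Set (EuclideanSpace ℝ (Fin n)))
      (F : ℝ × EuclideanSpace ℝ (Fin n) → EuclideanSpace ℝ (Fin n)),
      IsOpen W ∧ z ∈ W ∧ W ⊆ c.dom ∧ ContDiffOn ℝ ∞ F (Ioo (-ε) ε ×ˢ W) ∧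
        ∀ p ∈ Ioo (-ε) ε ×ˢ W, F p ∈ d.dom ∧ d.map (F p) = φ p.1 (c.map p.2) := by
  obtain ⟨d, hd, W, F, hW, hzW, hWc, hF, H⟩ := h
  refine ⟨d, hd, W, F, hW, hzW, hWc, hF, fun p hp => ⟨((H p.2 hp.2).2 p.1 hp.1).1, ?_⟩⟩
  have h1 := hφ.eq_of_isIntegralOn
    (isIntegralOn_of_hasDerivAt hd isOpen_Ioo (H p.2 hp.2).2) hp.1
  rwa [(H p.2 hp.2).1] at h1

theorem IsFlow.isSmoothMap [CompactSpace X] (hφ : v.IsFlow φ) (t : ℝ) :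
    A.IsSmoothMap A (φ t) := by
  obtain ⟨ε, hε, hflow⟩ := v.exists_forall_hasLocalFlow
  have hsmall : ∀ s ∈ Ioo (-ε) ε, A.IsSmoothMap A (φ s) := by
    intro s hs c hc z hz
    obtain ⟨d, hd, W, F, hW, hzW, hWc, hF, H⟩ := (hflow c hc z hz).exists_lift hφ
    exact ⟨d, hd, W, fun w => F (s, w), hW, hzW, hWc,
      hF.comp (contDiffOn_const.prodMk contDiffOn_id) fun w hw => ⟨hs, hw⟩,
      fun w hw => H (s, w) ⟨hs, hw⟩⟩
  have hmul : ∀ s ∈ Ioo (-ε) ε, ∀ k : ℕ, A.IsSmoothMap A (φ (k * s)) := by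
    intro s hs k
    induction k with
    | zero =>
      rw [show φ ((0 : ℕ) * s) = id by funext x; simp [hφ.map_zero]]
      exact A.isSmoothMap_id
    | succ k ih =>
      rw [show φ ((k + 1 : ℕ) * s) = φ s ∘ φ (k * s) by
        funext x
        rw [Function.comp_apply, ← hφ.map_add]
        congr 1
        push_cast
        ring]
      exact (hsmall s hs).comp ih
  -- Choose `N` with `|t| / N < ε`, so that `φ t` is the `N`-fold composite of a small-time map.
  obtain ⟨N, hN⟩ := exists_nat_gt (|t| / ε)
  have hN0 : (0 : ℝ) < N := lt_of_le_of_lt (by positivity) hN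
  have h := hmul (t / N) (abs_lt.1 (by
    rw [abs_div, Nat.abs_cast, div_lt_iff₀ hN0, mul_comm]
    exact (div_lt_iff₀ hε).1 hN)) N
  rwa [mul_div_cancel₀ _ hN0.ne'] at h

theorem IsFlow.isDiffeomorphism [CompactSpace X] (hφ : v.IsFlow φ) (t : ℝ) :
    A.IsDiffeomorphism A (φ t) :=
  ⟨hφ.isSmoothMap t, φ (-t), fun x => by rw [← hφ.map_add, neg_add_cancel, hφ.map_zero],
    fun x => by rw [← hφ.map_add, add_neg_cancel, hφ.map_zero], hφ.isSmoothMap (-t)⟩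

/-- For times `s` near `t`, `φ s` is `φ (s - t) ∘ φ t`: a smooth lift of `φ t` followed by the
jointly smooth local flow. -/
theorem IsFlow.isSmoothFamily [CompactSpace X] (hφ : v.IsFlow φ) : A.IsSmoothFamily φ := by
  obtain ⟨ε, hε, hflow⟩ := v.exists_forall_hasLocalFlow
  intro t c hc z hz
  obtain ⟨d, hd, V, G, hV, hzV, hVc, hG, hGd⟩ := hφ.isSmoothMap t c hc z hz
  obtain ⟨e, he, W, F, hW, hzW, -, hF, H⟩ := (hflow d hd (G z) (hGd z hzV).1).exists_lift hφ
  have hmem : ∀ p ∈ Ioo (t - ε) (t + ε) ×ˢ (V ∩ G ⁻¹' W), (p.1 - t, G p.2) ∈ Ioo (-ε) ε ×ˢ W :=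
    fun p hp => ⟨⟨by linarith [hp.1.1], by linarith [hp.1.2]⟩, hp.2.2⟩
  refine ⟨e, he, Ioo (t - ε) (t + ε) ×ˢ (V ∩ G ⁻¹' W), fun p => F (p.1 - t, G p.2),
    isOpen_Ioo.prod (hG.continuousOn.isOpen_inter_preimage hV hW),
    ⟨⟨by linarith, by linarith⟩, hzV, hzW⟩, fun p hp => hVc hp.2.1, ?_, fun p hp => ?_⟩
  · exact hF.comp (((contDiff_fst.sub contDiff_const).contDiffOn).prodMk
      (hG.comp contDiff_snd.contDiffOn fun p hp => hp.2.1)) hmem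
  · have h := H _ (hmem p hp)
    refine ⟨h.1, ?_⟩
    rw [h.2, (hGd _ hp.2.1).2, ← hφ.map_add, sub_add_cancel]

theorem IsFlow.isOneParameterGroup [CompactSpace X] (hφ : v.IsFlow φ) :
    A.IsOneParameterGroup φ :=
  ⟨hφ.map_zero, hφ.map_add, hφ.isDiffeomorphism, hφ.isSmoothFamily⟩

-- The orbit lifts to an integral curve through the prescribed preimage `z`, whichever it is, so the
-- chain rule in `c` gives the derivative.
omit [T2Space X] in
theorem IsFlow.hasDerivAt (hφ : v.IsFlow φ) {f : X → ℂ} (hf : A.IsSmoothFunction f)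
    (hc : c ∈ A.charts) (hz : z ∈ c.dom) :
    HasDerivAt (fun t : ℝ => f (φ t (c.map z))) (v.applyAt f c z) 0 := by
  obtain ⟨a, ha, rfl⟩ := (hφ.isIntegralOn (c.map z)).exists_lift (mem_univ 0) hc hz
    (hφ.map_zero _).symm
  have h1 : HasFDerivAt (fun w => f (c.map w)) (fderiv ℝ (fun w => f (c.map w)) (a 0)) (a 0) :=
    (((hf c hc).contDiffAt (c.isOpen_dom.mem_nhds hz)).differentiableAt (by simp)).hasFDerivAt
  refine (h1.comp_hasDerivAt 0 ha.self_of_nhds.2.2).congr_of_eventuallyEq ?_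
  filter_upwards [ha] with τ hτ
  rw [Function.comp_apply, hτ.2.1]

end VectorField

end OrbifoldAtlas

theorem theorem3p1 (n : ℕ) {Y : Type*} [TopologicalSpace Y] [T2Space Y] [CompactSpace Y]
    (A : OrbifoldAtlas n Y) (v : A.VectorField) :
    ∃ φ : ℝ → Y → Y, A.IsOneParameterGroup φ ∧
      ∀ f : Y → ℂ, A.IsSmoothFunction f →
        ∀ x : Y, ∀ c ∈ A.charts, ∀ z ∈ c.dom, c.map z = x →
          HasDerivAt (fun t : ℝ => f (φ t x)) (v.applyAt f c z) 0 := by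
  obtain ⟨φ, hφ⟩ := v.exists_isFlow
  refine ⟨φ, hφ.isOneParameterGroup, ?_⟩
  rintro f hf _ c hc z hz rfl
  exact hφ.hasDerivAt hf hc hz
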